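/- Let $k>0$, $\tau>0$, $\omega_0=\pi/\tau$, and let $u\in C^2([0,\tau])$ with $u(0)=0$. For $N\ge 0$ put $$J_N=\begin{bmatrix}0&\Omega_N&0\\-\Omega_N^T&0&0\\0&0&0\end{bmatrix},\quad \Omega_N=\mathrm{diag}(\omega_0,2\omega_0,\dots,N\omega_0),\quad B_N=\sqrt{\tfrac{k}{\tau}}\,\bigl(\underbrace{1,\dots,1}_{N},\underbrace{0,\dots,0}_{N},\tfrac1{\sqrt2}\bigr)^T,$$ $$\kappa_N(t)=\frac{k}{2\tau}+\sum_{l=1}^N\frac{k}{\tau}\cos(l\omega_0t),\qquad \kappa_N^c(t)=\kappa_N(t)\ (t\ge0),\quad \kappa_N^c(t)=0\ (t<0).$$ The lossless/causal approximation $K_N$ of the memoryless dissipative system $y=ku$ on $[0,\tau]$ is the system $(J_N,\sqrt2B_N,\sqrt2B_N^T)$ with output $$y_N(t)=\sqrt2\,B_N^Te^{J_Nt}x_N(0)+\int_0^t2\kappa_N^c(t-s)u(s)\,ds,$$ where the initial state $x_N(0)$ is a random vector in $\mathbb R^{2N+1}$ (on a probability space that may depend on $N$) with mean zero and finite second moments.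 Suppose that there is a number $T$ such that every $K_N$ has temperature $T$, i.e. the covariance function of its output is $$R_{y_N}(s,t)=\mathbf E[y_N(t)-\mathbf Ey_N(t)][y_N(s)-\mathbf Ey_N(s)]=T\cdot(\sqrt2B_N)^Te^{J_N(t-s)}(\sqrt2B_N),\qquad s,t\in[0,\tau].$$ Call smooth functions $\varphi$ on $\mathbb R$ supported in $[0,\tau]$ test functions. White noise of unit intensity on $[0,\tau]$ is a generalized stochastic process $w$, i.e. a map from test functions to square-integrable random variables that is almost surely linear, with $\mathbf E\,w(\varphi)=0$ and $\mathrm{Cov}(w(\varphi),w(\psi))=\int_0^\tau\varphi\psi\,dt$, that is, $\mathbf E\,w(t)w(s)=\delta(t-s)$. Such $w$ exist. Then, as $N\to\infty$, $y_N$ converges in mean and covariance, in the sense of distributions, to $$y_\infty(t)=ku(t)+\sqrt{2Tk}\,w(t),\qquad t\in[0,\tau],$$ for every unit-intensity white noise $w$ on $[0,\tau]$. That is, with $y_N(\varphi)=\int_0^\tau y_N(t)\varphi(t)\,dt$ and $y_\infty(\varphi)=\int_0^\tau ku(t)\varphi(t)\,dt+\sqrt{2Tk}\,w(\varphi)$,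 all these random variables are square-integrable and $$\mathbf E\,y_N(\varphi)\to\mathbf E\,y_\infty(\varphi),\qquad \mathrm{Cov}(y_N(\varphi),y_N(\psi))\to\mathrm{Cov}(y_\infty(\varphi),y_\infty(\psi))$$ for all test functions $\varphi,\psi$. Moreover $\mathbf E\,y_N(t)\to ku(t)$ uniformly on $[0,\tau]$, and $R_{y_N}(s,t)\to2Tk\,\delta(t-s)$ in the sense of distributions on $[0,\tau]^2$: for every smooth $\Phi$ on $\mathbb R^2$ supported in $[0,\tau]^2$, $$\int_0^\tau\!\!\int_0^\tau R_{y_N}(s,t)\,\Phi(s,t)\,ds\,dt\to2Tk\int_0^\tau\Phi(t,t)\,dt.$$ -/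

import Mathlib

open MeasureTheory ProbabilityTheory Filter Topology Set
open scoped Matrix

noncomputable section

namespace HeatBath

/-- Index set of the state space `ℝ^(2N+1)`, split in blocks of sizes `N`, `N`, `1`. -/
abbrev Idx (N : ℕ) : Type := (Fin N ⊕ Fin N) ⊕ Unit

/-- `Ω_N = diag(ω₀, 2ω₀, …, Nω₀)` with `ω₀ = π / τ`. -/
def OmegaMat (τ : ℝ) (N : ℕ) : Matrix (Fin N) (Fin N) ℝ :=
  Matrix.diagonal fun l => ((l : ℕ) + 1 : ℝ) * (Real.pi / τ)

/-- The skew-symmetric matrix `J_N`. -/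
def J (τ : ℝ) (N : ℕ) : Matrix (Idx N) (Idx N) ℝ :=
  Matrix.fromBlocks (Matrix.fromBlocks 0 (OmegaMat τ N) (-(OmegaMat τ N)ᵀ) 0) 0 0 0

/-- The vector `B_N = √(k/τ) (1, …, 1, 0, …, 0, 1/√2)ᵀ`. -/
def B (k τ : ℝ) (N : ℕ) : Idx N → ℝ :=
  Real.sqrt (k / τ) • Sum.elim (Sum.elim (fun _ => 1) (fun _ => 0)) (fun _ => 1 / Real.sqrt 2)

/-- The truncated Fourier series `κ_N(t) = k/(2τ) + ∑_{l=1}^N (k/τ) cos(l ω₀ t)`. -/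
def kappa (k τ : ℝ) (N : ℕ) (t : ℝ) : ℝ :=
  k / (2 * τ) + ∑ l ∈ Finset.Icc 1 N, k / τ * Real.cos ((l : ℝ) * (Real.pi / τ) * t)

/-- The causal part of `κ_N`. -/
def kappaCausal (k τ : ℝ) (N : ℕ) (t : ℝ) : ℝ :=
  if t < 0 then 0 else kappa k τ N t

/-- The output at time `t` of the approximation `K_N`, realized by `(J_N, √2 B_N, √2 B_Nᵀ)`,
with initial state `x₀` and input `u`. -/
def output (k τ : ℝ) (N : ℕ) (u : ℝ → ℝ) (x₀ : Idx N → ℝ) (t : ℝ) : ℝ :=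
  Real.sqrt 2 * (B k τ N ⬝ᵥ (NormedSpace.exp (t • J τ N) *ᵥ x₀)) +
    ∫ s in (0 : ℝ)..t, 2 * kappaCausal k τ N (t - s) * u s

/-- The system `ẋ = A x + b u`, `y = bᵀ x` with random output `y t ω` has temperature `T` on the
time interval `[0, τ]`: the covariance function of its output is `T bᵀ e^{A (t - s)} b`. -/
def HasTemperature {ι Ω : Type*} [Fintype ι] [DecidableEq ι] [MeasurableSpace Ω]
    (A : Matrix ι ι ℝ) (b : ι → ℝ) (T τ : ℝ) (P : Measure Ω) (y : ℝ → Ω → ℝ) : Prop :=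
  ∀ s ∈ Icc 0 τ, ∀ t ∈ Icc 0 τ,
    cov[y t, y s; P] = T * (b ⬝ᵥ (NormedSpace.exp ((t - s) • A) *ᵥ b))

/-- Smooth test functions supported in `[0, τ]`. -/
def IsTest (τ : ℝ) (φ : ℝ → ℝ) : Prop :=
  ContDiff ℝ ((⊤ : ℕ∞) : WithTop ℕ∞) φ ∧ tsupport φ ⊆ Icc 0 τ

/-- Smooth test functions of two variables supported in `[0, τ] × [0, τ]`. -/
def IsTest₂ (τ : ℝ) (Φ : ℝ × ℝ → ℝ) : Prop :=
  ContDiff ℝ ((⊤ : ℕ∞) : WithTop ℕ∞) Φ ∧ tsupport Φ ⊆ Icc 0 τ ×ˢ Icc 0 τ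

/-- `w` is stochastic white noise of unit intensity on `[0, τ]`: a generalized stochastic process
(a random variable `w φ` of finite variance for each test function `φ`, linear in `φ` almost
surely) with mean zero and covariance `E w(t) w(s) = δ(t - s)`. -/
structure IsWhiteNoise {Ω : Type*} [MeasurableSpace Ω] (τ : ℝ) (P : Measure Ω)
    (w : (ℝ → ℝ) → Ω → ℝ) : Prop where
  memLp : ∀ φ, IsTest τ φ → MemLp (w φ) 2 P
  add : ∀ φ ψ, IsTest τ φ → IsTest τ ψ → w (φ + ψ) =ᵐ[P] w φ + w ψ
  smul : ∀ (c : ℝ) φ, IsTest τ φ → w (c • φ) =ᵐ[P] c • w φ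
  mean : ∀ φ, IsTest τ φ → ∫ ω, w φ ω ∂P = 0
  covar : ∀ φ ψ, IsTest τ φ → IsTest τ ψ → cov[w φ, w ψ; P] = ∫ t in (0 : ℝ)..τ, φ t * ψ t

/-- The generalized process `φ ↦ ∫₀^τ y(t) φ(t) dt` given by an ordinary process `y`. -/
def toGeneralized {Ω : Type*} (τ : ℝ) (y : ℝ → Ω → ℝ) (φ : ℝ → ℝ) (ω : Ω) : ℝ :=
  ∫ t in (0 : ℝ)..τ, y t ω * φ t

/-- The generalized process `y_∞ = k u + √(2 T k) w`. -/
def limitOutput {Ω : Type*} (k T τ : ℝ) (u : ℝ → ℝ) (w : (ℝ → ℝ) → Ω → ℝ)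
    (φ : ℝ → ℝ) (ω : Ω) : ℝ :=
  (∫ t in (0 : ℝ)..τ, k * u t * φ t) + Real.sqrt (2 * T * k) * w φ ω

/-- Convergence of generalized processes of finite variance on `[0, τ]`, in mean and covariance;
the processes may live on different probability spaces. -/
structure ConvergesSecondOrder {Ω : ℕ → Type*} [∀ N, MeasurableSpace (Ω N)]
    {Ω' : Type*} [MeasurableSpace Ω'] (τ : ℝ) (P : ∀ N, Measure (Ω N)) (P' : Measure Ω')
    (Y : ∀ N, (ℝ → ℝ) → Ω N → ℝ) (Y' : (ℝ → ℝ) → Ω' → ℝ) : Prop where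
  memLp : ∀ N φ, IsTest τ φ → MemLp (Y N φ) 2 (P N)
  memLp_limit : ∀ φ, IsTest τ φ → MemLp (Y' φ) 2 P'
  mean : ∀ φ, IsTest τ φ →
    Tendsto (fun N => ∫ ω, Y N φ ω ∂(P N)) atTop (𝓝 (∫ ω, Y' φ ω ∂P'))
  covar : ∀ φ ψ, IsTest τ φ → IsTest τ ψ →
    Tendsto (fun N => cov[Y N φ, Y N ψ; P N]) atTop (𝓝 cov[Y' φ, Y' ψ; P'])

end HeatBath

end

/-! Both the response to `u` and the output covariance are governed by `2 κ_N`, because `Bᵀ e^{Jt} B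
= κ_N(t)` (`B_dotProduct_exp_J_mulVec_B`). The primitive `S_N` of `2 κ_N` with `S_N(0) = 0` is
`kt/τ` plus the `N`-th partial sum of the sine series of `k - kt/τ` on `[0, τ]`. So `S_N → k` in
`L²`; the squared error is computed exactly and vanishes in the limit because `∑ 1/l² = π²/6`
(`tendsto_stepError`).

If `f` is `C¹` and `f(0) = 0`, integration by parts gives `∫₀ᵗ 2κ_N(t-s) f(s) ds - k f(t) = ∫₀ᵗ
f'(s) (S_N(t-s) - k) ds`, which is at most `sup |f'|` times the `L¹` norm of `S_N - k`, uniformly in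
`t` (`abs_integral_kappa_mul_sub_le`). With `f = u` this settles the mean. Applied on both sides of
the diagonal to a test function, it gives `T · 2κ_N(t-s) → 2Tk δ(t-s)`.

The output is affine in a finite-dimensional random vector, so smeared means and covariances reduce
to finite sums. White noise exists because `L²(0, τ)` embeds isometrically into a space of centred
random variables. -/

namespace HeatBath

/-! ### Step response and its convergence in `L¹` -/

/-- The primitive of `2 κ_N` vanishing at zero, i.e. the step response of the approximation. -/
noncomputable def stepResponse (k τ : ℝ) (N : ℕ) (t : ℝ) : ℝ :=
  k / τ * t + ∑ l ∈ Finset.Icc 1 N, 2 * k / (l * Real.pi) * Real.sin (l * (Real.pi / τ) * t)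

lemma continuous_kappa (k τ : ℝ) (N : ℕ) : Continuous (kappa k τ N) := by
  unfold kappa; fun_prop

lemma kappa_neg (k τ : ℝ) (N : ℕ) (t : ℝ) : kappa k τ N (-t) = kappa k τ N t := by
  simp [kappa]

lemma continuous_stepResponse (k τ : ℝ) (N : ℕ) : Continuous (stepResponse k τ N) := by
  unfold stepResponse; fun_prop

lemma stepResponse_zero (k τ : ℝ) (N : ℕ) : stepResponse k τ N 0 = 0 := by
  simp [stepResponse]

lemma stepResponse_succ (k τ : ℝ) (N : ℕ) (t : ℝ) :
    stepResponse k τ (N + 1) t = stepResponse k τ N t +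
      2 * k / ((N + 1 : ℕ) * Real.pi) * Real.sin ((N + 1 : ℕ) * (Real.pi / τ) * t) := by
  simp only [stepResponse]
  rw [Finset.sum_Icc_succ_top (by omega)]
  ring

lemma hasDerivAt_stepResponse {k τ : ℝ} (hτ : 0 < τ) (N : ℕ) (t : ℝ) :
    HasDerivAt (stepResponse k τ N) (2 * kappa k τ N t) t := by
  have h : HasDerivAt (stepResponse k τ N) (k / τ * 1 + ∑ l ∈ Finset.Icc 1 N,
      2 * k / (l * Real.pi) * (Real.cos (l * (Real.pi / τ) * t) * (l * (Real.pi / τ) * 1))) t := by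
    unfold stepResponse
    refine ((hasDerivAt_id t).const_mul (k / τ)).add (HasDerivAt.fun_sum fun l _ => ?_)
    exact (((hasDerivAt_id t).const_mul _).sin).const_mul _
  convert h using 1
  simp only [kappa, mul_add, Finset.mul_sum]
  congr 1
  · field_simp
  · refine Finset.sum_congr rfl fun l hl => ?_
    have : (l : ℝ) ≠ 0 := by
      have := (Finset.mem_Icc.1 hl).1
      positivity
    have := Real.pi_ne_zero
    field_simp

lemma integral_cos_int_mul {τ : ℝ} (hτ : 0 < τ) {n : ℤ} (hn : n ≠ 0) :
    ∫ r in (0 : ℝ)..τ, Real.cos (n * (Real.pi / τ) * r) = 0 := by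
  have hn' : (n : ℝ) * (Real.pi / τ) ≠ 0 := by
    have : (n : ℝ) ≠ 0 := by exact_mod_cast hn
    have := Real.pi_pos
    positivity
  rw [intervalIntegral.integral_comp_mul_left (fun x => Real.cos x) hn', integral_cos]
  have : (n : ℝ) * (Real.pi / τ) * τ = n * Real.pi := by field_simp
  rw [this, Real.sin_int_mul_pi]
  simp

lemma integral_sin_mul_sin_of_ne {τ : ℝ} (hτ : 0 < τ) {l m : ℕ} (hlm : l ≠ m) (hl : 0 < l) :
    ∫ r in (0 : ℝ)..τ,
      Real.sin (l * (Real.pi / τ) * r) * Real.sin (m * (Real.pi / τ) * r) = 0 := by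
  have h : ∀ r : ℝ, Real.sin (l * (Real.pi / τ) * r) * Real.sin (m * (Real.pi / τ) * r) =
      (1 / 2) * Real.cos (((l - m : ℤ) : ℝ) * (Real.pi / τ) * r) -
      (1 / 2) * Real.cos (((l + m : ℤ) : ℝ) * (Real.pi / τ) * r) := by
    intro r
    push_cast
    rw [sub_mul, sub_mul, add_mul, add_mul, Real.cos_sub, Real.cos_add]
    ring
  simp_rw [h]
  rw [intervalIntegral.integral_sub (Continuous.intervalIntegrable (by fun_prop) _ _)
    (Continuous.intervalIntegrable (by fun_prop) _ _),
    intervalIntegral.integral_const_mul, intervalIntegral.integral_const_mul,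
    integral_cos_int_mul hτ (by omega), integral_cos_int_mul hτ (by omega)]
  simp

lemma integral_sin_sq_nat_mul {τ : ℝ} (hτ : 0 < τ) {m : ℕ} (hm : 0 < m) :
    ∫ r in (0 : ℝ)..τ, Real.sin (m * (Real.pi / τ) * r) ^ 2 = τ / 2 := by
  have h : ∀ r : ℝ, Real.sin (m * (Real.pi / τ) * r) ^ 2 =
      (1 / 2) - (1 / 2) * Real.cos (((2 * m : ℤ) : ℝ) * (Real.pi / τ) * r) := by
    intro r
    rw [Real.sin_sq_eq_half_sub]
    push_cast
    ring_nf
  simp_rw [h]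
  rw [intervalIntegral.integral_sub (by simp)
    (Continuous.intervalIntegrable (by fun_prop) _ _),
    intervalIntegral.integral_const_mul, integral_cos_int_mul hτ (by omega)]
  simp
  ring

lemma integral_affine_mul_sin {k τ : ℝ} (hτ : 0 < τ) {m : ℕ} (hm : 0 < m) :
    ∫ r in (0 : ℝ)..τ, (k / τ * r - k) * Real.sin (m * (Real.pi / τ) * r) =
      -(k * τ / (m * Real.pi)) := by
  have hm' : (m : ℝ) ≠ 0 := by positivity
  have hpi := Real.pi_ne_zero
  set a : ℝ := m * (Real.pi / τ) with ha
  have ha0 : a ≠ 0 := by rw [ha]; positivity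
  -- The antiderivative comes from one integration by parts.
  have hF : ∀ r ∈ uIcc (0 : ℝ) τ, HasDerivAt
      (fun r => (k / τ * r - k) * (-Real.cos (a * r) / a) + k / τ * (Real.sin (a * r) / a ^ 2))
      ((k / τ * r - k) * Real.sin (a * r)) r := by
    intro r _
    have hid := (hasDerivAt_id r).const_mul a
    have h1 := ((((hasDerivAt_id r).const_mul (k / τ)).sub_const k).mul
      ((hid.cos.neg).div_const a)).add ((hid.sin.div_const (a ^ 2)).const_mul (k / τ))
    refine HasDerivAt.congr_deriv h1 ?_
    simp only [id_eq, mul_one, Pi.neg_apply]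
    field_simp
    ring
  rw [intervalIntegral.integral_eq_sub_of_hasDerivAt hF
    (Continuous.intervalIntegrable (by fun_prop) _ _)]
  have : a * τ = m * Real.pi := by rw [ha]; field_simp
  rw [this, Real.sin_nat_mul_pi]
  simp
  rw [ha]
  field_simp
  ring

/-- The sines in `stepResponse` have frequencies at most `N < m`, hence are orthogonal to the one
tested; only the affine part contributes. -/
lemma integral_stepResponse_sub_mul_sin {k τ : ℝ} (hτ : 0 < τ) {N m : ℕ} (hm : N < m) :
    ∫ r in (0 : ℝ)..τ, (stepResponse k τ N r - k) * Real.sin (m * (Real.pi / τ) * r) =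
      -(k * τ / (m * Real.pi)) := by
  induction N with
  | zero => simpa [stepResponse] using integral_affine_mul_sin (k := k) hτ hm
  | succ N ih =>
    have hS := continuous_stepResponse k τ N
    have h : ∀ r, (stepResponse k τ (N + 1) r - k) * Real.sin (m * (Real.pi / τ) * r) =
        (stepResponse k τ N r - k) * Real.sin (m * (Real.pi / τ) * r) +
        2 * k / ((N + 1 : ℕ) * Real.pi) * (Real.sin ((N + 1 : ℕ) * (Real.pi / τ) * r) *
          Real.sin (m * (Real.pi / τ) * r)) := by
      intro r
      rw [stepResponse_succ]
      ring
    simp_rw [h]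
    rw [intervalIntegral.integral_add (Continuous.intervalIntegrable (by fun_prop) _ _)
      (Continuous.intervalIntegrable (by fun_prop) _ _), ih (by omega),
      intervalIntegral.integral_const_mul, integral_sin_mul_sin_of_ne hτ (by omega) (by omega)]
    simp

/-- The defect in Bessel's inequality: by orthogonality the sine of frequency `l` lowers the squared
norm by `2k²τ/(lπ)²`, starting from `k²τ/3`. The term `l = 0` is zero since `1 / 0 = 0`, which
matches the indexing of `hasSum_zeta_two`. -/
lemma integral_stepResponse_sub_sq {k τ : ℝ} (hτ : 0 < τ) (N : ℕ) :
    ∫ r in (0 : ℝ)..τ, (stepResponse k τ N r - k) ^ 2 =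
      k ^ 2 * τ * (1 / 3 - 2 / Real.pi ^ 2 * ∑ l ∈ Finset.range (N + 1), 1 / (l : ℝ) ^ 2) := by
  have hpi := Real.pi_ne_zero
  induction N with
  | zero =>
    have h : ∀ r, (stepResponse k τ 0 r - k) ^ 2 =
        k ^ 2 / τ ^ 2 * r ^ 2 - 2 * k ^ 2 / τ * r + k ^ 2 := by
      intro r
      simp only [stepResponse, zero_lt_one, Finset.Icc_eq_empty_of_lt, Finset.sum_empty, add_zero]
      ring
    simp_rw [h]
    rw [intervalIntegral.integral_add (Continuous.intervalIntegrable (by fun_prop) _ _)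
      (Continuous.intervalIntegrable (by fun_prop) _ _),
      intervalIntegral.integral_sub (Continuous.intervalIntegrable (by fun_prop) _ _)
      (Continuous.intervalIntegrable (by fun_prop) _ _),
      intervalIntegral.integral_const_mul, intervalIntegral.integral_const_mul, integral_pow,
      integral_id]
    simp
    field_simp
    ring
  | succ N ih =>
    have hS := continuous_stepResponse k τ N
    set c : ℝ := 2 * k / ((N + 1 : ℕ) * Real.pi) with hc
    have h : ∀ r, (stepResponse k τ (N + 1) r - k) ^ 2 = (stepResponse k τ N r - k) ^ 2 +
        2 * c * ((stepResponse k τ N r - k) * Real.sin ((N + 1 : ℕ) * (Real.pi / τ) * r)) +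
        c ^ 2 * Real.sin ((N + 1 : ℕ) * (Real.pi / τ) * r) ^ 2 := by
      intro r
      rw [stepResponse_succ]
      ring
    simp_rw [h]
    rw [intervalIntegral.integral_add (Continuous.intervalIntegrable (by fun_prop) _ _)
      (Continuous.intervalIntegrable (by fun_prop) _ _),
      intervalIntegral.integral_add (Continuous.intervalIntegrable (by fun_prop) _ _)
      (Continuous.intervalIntegrable (by fun_prop) _ _),
      intervalIntegral.integral_const_mul, intervalIntegral.integral_const_mul, ih,
      integral_stepResponse_sub_mul_sin hτ (by omega), integral_sin_sq_nat_mul hτ (by omega),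
      Finset.sum_range_succ _ (N + 1), hc]
    have : ((N + 1 : ℕ) : ℝ) ≠ 0 := by positivity
    field_simp
    ring

/-- Cauchy–Schwarz, obtained by integrating the squared deviation of `|f|` from its average `c`. -/
lemma sq_integral_abs_le {τ : ℝ} (hτ : 0 < τ) {f : ℝ → ℝ} (hf : Continuous f) :
    (∫ r in (0 : ℝ)..τ, |f r|) ^ 2 ≤ τ * ∫ r in (0 : ℝ)..τ, f r ^ 2 := by
  set c := (∫ r in (0 : ℝ)..τ, |f r|) / τ with hc
  have h0 : 0 ≤ ∫ r in (0 : ℝ)..τ, (|f r| - c) ^ 2 :=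
    intervalIntegral.integral_nonneg hτ.le fun _ _ => sq_nonneg _
  have h : ∀ r, (|f r| - c) ^ 2 = f r ^ 2 - 2 * c * |f r| + c ^ 2 := by
    intro r
    rw [← sq_abs (f r)]
    ring
  simp_rw [h] at h0
  rw [intervalIntegral.integral_add (Continuous.intervalIntegrable (by fun_prop) _ _)
      (Continuous.intervalIntegrable (by fun_prop) _ _),
      intervalIntegral.integral_sub (Continuous.intervalIntegrable (by fun_prop) _ _)
      (Continuous.intervalIntegrable (by fun_prop) _ _),
      intervalIntegral.integral_const_mul, intervalIntegral.integral_const] at h0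
  have h1 : ∫ r in (0 : ℝ)..τ, |f r| = c * τ := by rw [hc]; field_simp
  rw [h1] at h0 ⊢
  simp only [sub_zero, smul_eq_mul] at h0
  nlinarith

/-- The `L¹` distance on `[0, τ]` between the step response and the step of height `k`. -/
noncomputable def stepError (k τ : ℝ) (N : ℕ) : ℝ := ∫ r in (0 : ℝ)..τ, |stepResponse k τ N r - k|

lemma stepError_nonneg {k τ : ℝ} (hτ : 0 < τ) (N : ℕ) : 0 ≤ stepError k τ N :=
  intervalIntegral.integral_nonneg hτ.le fun _ _ => abs_nonneg _

lemma tendsto_stepError {k τ : ℝ} (hτ : 0 < τ) :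
    Tendsto (stepError k τ) atTop (𝓝 0) := by
  have hsum : Tendsto (fun N : ℕ => ∑ l ∈ Finset.range (N + 1), 1 / (l : ℝ) ^ 2) atTop
      (𝓝 (Real.pi ^ 2 / 6)) :=
    (tendsto_add_atTop_iff_nat 1).2 hasSum_zeta_two.tendsto_sum_nat
  have h1 : Tendsto (fun N => Real.sqrt (τ * ∫ r in (0 : ℝ)..τ, (stepResponse k τ N r - k) ^ 2))
      atTop (𝓝 0) := by
    simp_rw [integral_stepResponse_sub_sq hτ]
    have := (((hsum.const_mul (2 / Real.pi ^ 2)).const_sub (1 / 3)).const_mul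
      (k ^ 2 * τ)).const_mul τ |>.sqrt
    -- The limit is zero because `1/3 = (2/π²)(π²/6)`.
    convert this using 2
    have hpi := Real.pi_ne_zero
    field_simp
    norm_num
  refine squeeze_zero (stepError_nonneg hτ) (fun N => Real.le_sqrt_of_sq_le ?_) h1
  exact sq_integral_abs_le hτ ((continuous_stepResponse k τ N).sub continuous_const)

/-! ### Convolution with the kernel -/

/-- Quantitative convergence of the causal convolution with `2 κ_N` to multiplication by `k`. -/
lemma abs_integral_kappa_mul_sub_le {k τ : ℝ} (hτ : 0 < τ) (N : ℕ) {f f' : ℝ → ℝ} {M : ℝ}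
    (hf : ContinuousOn f (Icc 0 τ)) (hf' : ContinuousOn f' (Icc 0 τ))
    (hd : ∀ s ∈ Ioo 0 τ, HasDerivAt f (f' s) s) (h0 : f 0 = 0)
    (hM : ∀ s ∈ Icc 0 τ, |f' s| ≤ M) {t : ℝ} (ht : t ∈ Icc 0 τ) :
    |(∫ s in (0 : ℝ)..t, 2 * kappa k τ N (t - s) * f s) - k * f t| ≤ M * stepError k τ N := by
  have hsub : uIcc 0 t ⊆ Icc 0 τ := by
    rw [uIcc_of_le ht.1]; exact Icc_subset_Icc_right ht.2
  have hM0 : 0 ≤ M := (abs_nonneg _).trans (hM 0 ⟨le_rfl, hτ.le⟩)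
  have hS := continuous_stepResponse k τ N
  have hκ := continuous_kappa k τ N
  have hd' : ∀ s ∈ Ioo (min 0 t) (max 0 t), HasDerivAt f (f' s) s := by
    rw [min_eq_left ht.1, max_eq_right ht.1]
    exact fun s hs => hd s ⟨hs.1, hs.2.trans_le ht.2⟩
  -- The constant `k` in `v` makes `v t = k`, so the boundary term at `t` is the expected limit `k
  -- f(t)`; the one at `0` vanishes with `f 0`.
  have hibp := intervalIntegral.integral_mul_deriv_eq_deriv_mul_of_hasDerivAt
    (u := f) (u' := f') (v := fun s => k - stepResponse k τ N (t - s))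
    (v' := fun s => 2 * kappa k τ N (t - s)) (a := 0) (b := t) (hf.mono hsub)
    (Continuous.continuousOn (by fun_prop)) hd'
    (fun s _ => by
      have h1 := (hasDerivAt_stepResponse (k := k) hτ N (t - s)).comp s
        ((hasDerivAt_id s).const_sub t)
      exact (h1.const_sub k).congr_deriv (by simp))
    ((hf'.mono hsub).intervalIntegrable) (Continuous.intervalIntegrable (by fun_prop) _ _)
  have heq : (∫ s in (0 : ℝ)..t, 2 * kappa k τ N (t - s) * f s) - k * f t =
      ∫ s in (0 : ℝ)..t, f' s * (stepResponse k τ N (t - s) - k) := by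
    have e1 : ∀ s, 2 * kappa k τ N (t - s) * f s = f s * (2 * kappa k τ N (t - s)) :=
      fun s => mul_comm _ _
    simp_rw [e1]
    rw [hibp, h0]
    simp only [sub_self, stepResponse_zero, sub_zero, zero_mul]
    rw [mul_comm, sub_sub_cancel_left, ← intervalIntegral.integral_neg]
    congr 1
    ext s
    ring
  rw [heq]
  calc |∫ s in (0 : ℝ)..t, f' s * (stepResponse k τ N (t - s) - k)|
      ≤ ∫ s in (0 : ℝ)..t, M * |stepResponse k τ N (t - s) - k| := by
        rw [← Real.norm_eq_abs]
        refine intervalIntegral.norm_integral_le_of_norm_le ht.1 ?_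
          (Continuous.intervalIntegrable (by fun_prop) _ _)
        refine Eventually.of_forall fun s hs => ?_
        rw [norm_mul, Real.norm_eq_abs, Real.norm_eq_abs]
        exact mul_le_mul_of_nonneg_right (hM s ⟨hs.1.le, hs.2.trans ht.2⟩) (abs_nonneg _)
    _ = M * ∫ s in (0 : ℝ)..t, |stepResponse k τ N s - k| := by
        rw [intervalIntegral.integral_const_mul,
          intervalIntegral.integral_comp_sub_left (fun s => |stepResponse k τ N s - k|)]
        simp
    -- Enlarging `[0, t]` to `[0, τ]` makes the bound uniform in `t`.
    _ ≤ M * stepError k τ N := by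
        refine mul_le_mul_of_nonneg_left ?_ hM0
        exact intervalIntegral.integral_mono_interval le_rfl ht.1 ht.2
          (Eventually.of_forall fun _ => abs_nonneg _)
          (Continuous.intervalIntegrable (by fun_prop) _ _)

/-- Quantitative convergence of the two-sided convolution with `2 κ_N` to multiplication
by `2 k`. -/
lemma abs_integral_kappa_mul_sub_le_two_sided {k τ : ℝ} (hτ : 0 < τ) (N : ℕ) {f f' : ℝ → ℝ}
    {M : ℝ} (hf' : Continuous f') (hd : ∀ s, HasDerivAt f (f' s) s) (h0 : f 0 = 0)
    (h1 : f τ = 0) (hM : ∀ s ∈ Icc 0 τ, |f' s| ≤ M) {t : ℝ} (ht : t ∈ Icc 0 τ) :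
    |(∫ s in (0 : ℝ)..τ, 2 * kappa k τ N (t - s) * f s) - 2 * k * f t| ≤
      2 * M * stepError k τ N := by
  have hκ := continuous_kappa k τ N
  have hf : Continuous f := continuous_iff_continuousAt.2 fun s => (hd s).continuousAt
  have hrefl : ∀ s ∈ Icc 0 τ, τ - s ∈ Icc 0 τ := fun s hs => ⟨by linarith [hs.2], by linarith [hs.1]⟩
  have hleft := abs_integral_kappa_mul_sub_le (k := k) hτ N hf.continuousOn hf'.continuousOn
    (fun s _ => hd s) h0 hM ht
  -- The half `[t, τ]` is reflected by `s ↦ τ - s` onto `[0, τ - t]`; `κ_N` is even and `f τ = 0`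
  -- becomes the initial condition. Each half contributes `k f(t)`.
  have hright := abs_integral_kappa_mul_sub_le (k := k) hτ N (f := fun s => f (τ - s))
    (f' := fun s => -f' (τ - s)) (M := M) (Continuous.continuousOn (by fun_prop))
    (Continuous.continuousOn (by fun_prop))
    (fun s _ => 
      ((hd (τ - s)).comp s ((hasDerivAt_id s).const_sub τ)).congr_deriv (by simp))
    (by simpa using h1) (fun s hs => by simpa using hM _ (hrefl s hs)) (hrefl t ht)
  have hsubst : ∫ s in (0 : ℝ)..(τ - t), 2 * kappa k τ N (τ - t - s) * f (τ - s) =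
      ∫ s in t..τ, 2 * kappa k τ N (t - s) * f s := by
    have := intervalIntegral.integral_comp_sub_left
      (fun s => 2 * kappa k τ N (t - s) * f s) τ (a := 0) (b := τ - t)
    rw [sub_sub_cancel, sub_zero] at this
    rw [← this]
    congr 1
    ext s
    rw [← kappa_neg]
    ring_nf
  rw [hsubst, sub_sub_cancel] at hright
  rw [← intervalIntegral.integral_add_adjacent_intervals (b := t)
    (Continuous.intervalIntegrable (by fun_prop) _ _)
    (Continuous.intervalIntegrable (by fun_prop) _ _)]
  rw [abs_le] at *
  constructor <;> linarith [hleft.1, hleft.2, hright.1, hright.2]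

/-! ### Matrix exponential and impulse response -/

section MatrixExp

attribute [local instance] Matrix.linftyOpNormedRing Matrix.linftyOpNormedAlgebra

lemma hasDerivAt_exp_smul_matrix {ι : Type*} [Fintype ι] [DecidableEq ι]
    (A : Matrix ι ι ℝ) (t : ℝ) (i j : ι) :
    HasDerivAt (fun r : ℝ => NormedSpace.exp (r • A) i j) ((NormedSpace.exp (t • A) * A) i j) t := by
  have h := hasDerivAt_exp_smul_const (𝕂 := ℝ) A t
  exact (hasDerivAt_pi.1 ((hasDerivAt_pi.1 h) i)) j

end MatrixExp

lemma exp_smul_mul_exp_neg_smul {ι : Type*} [Fintype ι] [DecidableEq ι]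
    (A : Matrix ι ι ℝ) (t : ℝ) :
    NormedSpace.exp (t • A) * NormedSpace.exp ((-t) • A) = 1 := by
  rw [← Matrix.exp_add_of_commute _ _ (((Commute.refl A).smul_left t).smul_right (-t))]
  simp

lemma continuous_exp_smul_matrix_apply {ι : Type*} [Fintype ι] [DecidableEq ι]
    (A : Matrix ι ι ℝ) (i j : ι) : Continuous fun t : ℝ => NormedSpace.exp (t • A) i j :=
  continuous_iff_continuousAt.2 fun t => (hasDerivAt_exp_smul_matrix A t i j).continuousAt

/-- A solution of `ẋ = A x` is given by the matrix exponential. -/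
lemma exp_smul_mulVec_eq_of_hasDerivAt {ι : Type*} [Fintype ι] [DecidableEq ι]
    {A : Matrix ι ι ℝ} {v : ℝ → ι → ℝ} (hv : ∀ t i, HasDerivAt (fun r => v r i) ((A *ᵥ v t) i) t)
    (t : ℝ) : NormedSpace.exp (t • A) *ᵥ v 0 = v t := by
  -- The curve `e^{-rA} v(r)` is constant.
  have hconst : ∀ i, ∀ r, HasDerivAt
      (fun r : ℝ => (NormedSpace.exp ((-r) • A) *ᵥ v r) i) 0 r := by
    intro i r
    have h1 : ∀ j, HasDerivAt (fun r : ℝ => NormedSpace.exp ((-r) • A) i j)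
        (-(NormedSpace.exp ((-r) • A) * A) i j) r := fun j =>
      ((hasDerivAt_exp_smul_matrix A (-r) i j).comp r (hasDerivAt_neg r)).congr_deriv (by simp)
    have h2 := HasDerivAt.fun_sum (u := Finset.univ) fun j _ => (h1 j).mul (hv r j)
    refine HasDerivAt.congr_deriv h2 ?_
    rw [Finset.sum_add_distrib]
    simp only [neg_mul, Finset.sum_neg_distrib]
    have e := congrFun (Matrix.mulVec_mulVec (v r) (NormedSpace.exp ((-r) • A)) A) i
    simp only [Matrix.mulVec, dotProduct] at e ⊢
    rw [e]
    ring
  have hv0 : NormedSpace.exp ((-t) • A) *ᵥ v t = v 0 := by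
    ext i
    have := is_const_of_deriv_eq_zero (fun r => (hconst i r).differentiableAt)
      (fun r => (hconst i r).deriv) t 0
    simpa using this
  rw [← hv0, Matrix.mulVec_mulVec, exp_smul_mul_exp_neg_smul, Matrix.one_mulVec]

/-- The free evolution `e^{J_N t} B_N`. -/
noncomputable def freeFlow (k τ : ℝ) (N : ℕ) (t : ℝ) : Idx N → ℝ :=
  Real.sqrt (k / τ) • Sum.elim
    (Sum.elim (fun l : Fin N => Real.cos (((l : ℕ) + 1 : ℝ) * (Real.pi / τ) * t))
      (fun l : Fin N => -Real.sin (((l : ℕ) + 1 : ℝ) * (Real.pi / τ) * t)))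
    (fun _ => 1 / Real.sqrt 2)

lemma exp_J_mulVec_B (k τ : ℝ) (N : ℕ) (t : ℝ) :
    NormedSpace.exp (t • J τ N) *ᵥ B k τ N = freeFlow k τ N t := by
  have h0 : B k τ N = freeFlow k τ N 0 := by
    simp [B, freeFlow]
  rw [h0]
  refine exp_smul_mulVec_eq_of_hasDerivAt (fun t i => ?_) t
  have harg : ∀ l : Fin N, HasDerivAt (fun r : ℝ => ((l : ℕ) + 1 : ℝ) * (Real.pi / τ) * r)
      (((l : ℕ) + 1 : ℝ) * (Real.pi / τ) * 1) t := fun l => (hasDerivAt_id t).const_mul _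
  rcases i with (l | l) | l
  · refine HasDerivAt.congr_deriv (((harg l).cos).const_mul (Real.sqrt (k / τ))) ?_
    simp [J, freeFlow, OmegaMat, Matrix.mulVec, dotProduct, Matrix.diagonal_apply]
    ring
  · refine HasDerivAt.congr_deriv (((harg l).sin.neg).const_mul (Real.sqrt (k / τ))) ?_
    simp [J, freeFlow, OmegaMat, Matrix.mulVec, dotProduct, Matrix.diagonal_apply]
    ring
  · refine HasDerivAt.congr_deriv (hasDerivAt_const t (Real.sqrt (k / τ) * (1 / Real.sqrt 2))) ?_
    simp [J, Matrix.mulVec, dotProduct]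

/-- The zero block of `B` discards the sines of `freeFlow`; the last coordinate gives `(k/τ)(1/√2)²
= k/(2τ)`. -/
lemma B_dotProduct_exp_J_mulVec_B {k τ : ℝ} (hk : 0 < k) (hτ : 0 < τ) (N : ℕ) (t : ℝ) :
    B k τ N ⬝ᵥ (NormedSpace.exp (t • J τ N) *ᵥ B k τ N) = kappa k τ N t := by
  have hsq : Real.sqrt (k / τ) * Real.sqrt (k / τ) = k / τ := Real.mul_self_sqrt (by positivity)
  have h2 : Real.sqrt 2 * Real.sqrt 2 = 2 := Real.mul_self_sqrt (by norm_num)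
  rw [exp_J_mulVec_B, B, freeFlow, smul_dotProduct, dotProduct_smul, smul_smul, hsq]
  have hsum : ∑ l : Fin N, Real.cos (((l : ℕ) + 1 : ℝ) * (Real.pi / τ) * t) =
      ∑ l ∈ Finset.Icc 1 N, Real.cos ((l : ℝ) * (Real.pi / τ) * t) := by
    rw [Fin.sum_univ_eq_sum_range (fun l : ℕ => Real.cos (((l : ℝ) + 1) * (Real.pi / τ) * t)),
      Finset.range_eq_Ico, ← Finset.Ico_succ_right_eq_Icc]
    have := Finset.sum_Ico_add' (fun l : ℕ => Real.cos ((l : ℝ) * (Real.pi / τ) * t)) 0 N 1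
    simpa using this
  simp only [dotProduct, Fintype.sum_sum_type, Sum.elim_inl, Sum.elim_inr, one_mul, zero_mul,
    Finset.sum_const_zero, add_zero, hsum, kappa, ← Finset.mul_sum, smul_eq_mul]
  generalize ∑ l ∈ Finset.Icc 1 N, Real.cos ((l : ℝ) * (Real.pi / τ) * t) = c
  simp only [Finset.univ_unique, Finset.sum_const, Finset.card_singleton, one_smul,
    one_div_mul_one_div, h2]
  field_simp
  ring

/-! ### Existence of white noise -/

/-- Every real Hilbert space embeds isometrically into the centred random variables of some
probability space; the probability space is a product of standard Gaussians. -/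
lemma exists_isometry_centred_L2 (H : Type) [NormedAddCommGroup H] [InnerProductSpace ℝ H]
    [CompleteSpace H] :
    ∃ (Ω' : Type) (_ : MeasurableSpace Ω') (P' : Measure Ω') (W : H →ₗᵢ[ℝ] Lp ℝ 2 P'),
      IsProbabilityMeasure P' ∧ ∀ h, ∫ ω, W h ω ∂P' = 0 := by
  obtain ⟨ι, b, -⟩ := exists_hilbertBasis ℝ H
  set P' : Measure (ι → ℝ) := Measure.infinitePi fun _ => gaussianReal 0 1 with hP'
  have hmp : ∀ i : ι, MeasurePreserving (fun ω : ι → ℝ => ω i) P' (gaussianReal 0 1) := fun i =>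
    ⟨measurable_pi_apply i, Measure.infinitePi_map_eval _ i⟩
  have hL : ∀ i : ι, MemLp (fun ω : ι → ℝ => ω i) 2 P' := fun i =>
    (memLp_id_gaussianReal (μ := 0) (v := 1) 2).comp_measurePreserving (hmp i)
  have hmean : ∀ i : ι, ∫ ω, ω i ∂P' = 0 := fun i => by
    have h := integral_map (μ := P') (φ := fun ω : ι → ℝ => ω i) (f := id)
      (measurable_pi_apply i).aemeasurable aestronglyMeasurable_id
    rw [(hmp i).map_eq] at h
    simpa using h.symm
  have hvar : ∀ i : ι, Var[fun ω : ι → ℝ => ω i; P'] = 1 := fun i => by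
    have h := variance_map (μ := P') (Y := fun ω : ι → ℝ => ω i) (X := id)
      aemeasurable_id (measurable_pi_apply i).aemeasurable
    rw [(hmp i).map_eq, variance_id_gaussianReal] at h
    simpa using h.symm
  have hind : iIndepFun (fun (i : ι) (ω : ι → ℝ) => ω i) P' :=
    iIndepFun_infinitePi (X := fun _ => id) fun _ => measurable_id
  have hinner : ∀ i j : ι, inner ℝ ((hL i).toLp _) ((hL j).toLp _) =
      cov[fun ω : ι → ℝ => ω i, fun ω : ι → ℝ => ω j; P'] := by
    intro i j
    rw [covariance_eq_sub (hL i) (hL j), hmean, zero_mul, sub_zero, L2.inner_def]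
    refine integral_congr_ae ?_
    filter_upwards [(hL i).coeFn_toLp, (hL j).coeFn_toLp] with ω hi hj
    rw [hi, hj]
    simp [mul_comm]
  have horth : Orthonormal ℝ fun i : ι => (hL i).toLp _ := by
    classical
    rw [orthonormal_iff_ite]
    intro i j
    rw [hinner]
    split_ifs with hij
    · rw [hij, covariance_self (measurable_pi_apply j).aemeasurable, hvar]
    · exact (hind.indepFun hij).covariance_eq_zero (hL i) (hL j)
  -- The Hilbert basis is sent to the orthonormal Gaussian coordinates.
  refine ⟨ι → ℝ, inferInstance, P',
    horth.orthogonalFamily.linearIsometry.comp b.repr.toLinearIsometry, inferInstance, fun h => ?_⟩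
  have hone : MemLp (fun _ : ι → ℝ => (1 : ℝ)) 2 P' := memLp_const 1
  -- The mean is the inner product with `1`, hence continuous, so it vanishes on the series because
  -- it vanishes on each coordinate.
  have hint : ∀ g : Lp ℝ 2 P', inner ℝ (hone.toLp _) g = ∫ ω, g ω ∂P' := by
    intro g
    rw [L2.inner_def]
    refine integral_congr_ae ?_
    filter_upwards [hone.coeFn_toLp] with ω hω
    rw [hω]
    simp
  have hsum := (horth.orthogonalFamily.hasSum_linearIsometry (b.repr h)).mapL
    (innerSL ℝ (hone.toLp _))
  have hzero : ∀ i : ι, innerSL ℝ (hone.toLp _)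
      (LinearIsometry.toSpanSingleton ℝ (Lp ℝ 2 P') (horth.1 i) (b.repr h i)) = 0 := by
    intro i
    rw [LinearIsometry.toSpanSingleton_apply, map_smul, innerSL_apply_apply, hint,
      integral_congr_ae (hL i).coeFn_toLp, hmean, smul_zero]
  simp_rw [hzero] at hsum
  rw [← hint]
  exact hsum.unique hasSum_zero

lemma IsTest.continuous {τ : ℝ} {φ : ℝ → ℝ} (hφ : IsTest τ φ) : Continuous φ := hφ.1.continuous

lemma IsTest.memLp {τ : ℝ} {φ : ℝ → ℝ} (hφ : IsTest τ φ) :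
    MemLp φ 2 (volume.restrict (Ioc 0 τ)) :=
  (hφ.continuous.memLp_of_hasCompactSupport
    (isCompact_Icc.of_isClosed_subset (isClosed_tsupport φ) hφ.2)).restrict _

/-- Unit white noise on `[0, τ]` exists. -/
lemma exists_isWhiteNoise {τ : ℝ} (hτ : 0 < τ) :
    ∃ (Ω' : Type) (_ : MeasurableSpace Ω') (P' : Measure Ω') (w : (ℝ → ℝ) → Ω' → ℝ),
      IsProbabilityMeasure P' ∧ IsWhiteNoise τ P' w := by
  classical
  obtain ⟨Ω', _, P', W, hP', hW⟩ :=
    exists_isometry_centred_L2 (Lp ℝ 2 (volume.restrict (Ioc (0 : ℝ) τ)))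
  let w : (ℝ → ℝ) → Ω' → ℝ := fun φ =>
    if h : MemLp φ 2 (volume.restrict (Ioc (0 : ℝ) τ)) then W (h.toLp φ) else 0
  have hw : ∀ {φ} (h : MemLp φ 2 (volume.restrict (Ioc (0 : ℝ) τ))), w φ = W (h.toLp φ) :=
    fun h => dif_pos h
  refine ⟨Ω', _, P', w, hP', ⟨fun φ hφ => ?_, fun φ ψ hφ hψ => ?_, fun c φ hφ => ?_,
    fun φ hφ => ?_, fun φ ψ hφ hψ => ?_⟩⟩
  · rw [hw hφ.memLp]
    exact Lp.memLp _
  · rw [hw hφ.memLp, hw hψ.memLp, hw (hφ.memLp.add hψ.memLp), MemLp.toLp_add, map_add]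
    exact Lp.coeFn_add _ _
  · rw [hw hφ.memLp, hw (hφ.memLp.const_smul c), MemLp.toLp_const_smul, map_smul]
    exact Lp.coeFn_smul _ _
  · rw [hw hφ.memLp]
    exact hW _
  · rw [hw hφ.memLp, hw hψ.memLp, covariance_eq_sub (Lp.memLp _) (Lp.memLp _), hW, zero_mul,
      sub_zero]
    have h1 := W.inner_map_map (hφ.memLp.toLp φ) (hψ.memLp.toLp ψ)
    rw [L2.inner_def, L2.inner_def] at h1
    rw [intervalIntegral.integral_of_le hτ.le]
    calc _ = _ := by simp [mul_comm]
      _ = _ := h1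
      _ = _ := by
        refine integral_congr_ae ?_
        filter_upwards [hφ.memLp.coeFn_toLp, hψ.memLp.coeFn_toLp] with t h2 h3
        rw [h2, h3]
        simp [mul_comm]

/-! ### Moments of affine functions of a random vector -/

section Affine

variable {ι Ω : Type*} [Fintype ι] [MeasurableSpace Ω] {P : Measure Ω} [IsProbabilityMeasure P]
  {x : Ω → ι → ℝ}

lemma memLp_affine (hx : ∀ i, MemLp (fun ω => x ω i) 2 P) (a : ι → ℝ) (c : ℝ) :
    MemLp (fun ω => ∑ i, a i * x ω i + c) 2 P :=
  (memLp_finsetSum _ fun i _ => (hx i).const_mul (a i)).add (memLp_const c)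

lemma integral_affine (hx : ∀ i, MemLp (fun ω => x ω i) 2 P) (hx0 : ∀ i, ∫ ω, x ω i ∂P = 0)
    (a : ι → ℝ) (c : ℝ) : ∫ ω, (∑ i, a i * x ω i + c) ∂P = c := by
  have hi : ∀ i, Integrable (fun ω => a i * x ω i) P := fun i =>
    ((hx i).integrable one_le_two).const_mul _
  rw [integral_add (integrable_finsetSum _ fun i _ => hi i) (integrable_const c),
    integral_finsetSum _ fun i _ => hi i]
  simp [integral_const_mul, hx0]

lemma covariance_affine (hx : ∀ i, MemLp (fun ω => x ω i) 2 P) (a b : ι → ℝ) (c d : ℝ) :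
    cov[fun ω => ∑ i, a i * x ω i + c, fun ω => ∑ i, b i * x ω i + d; P] =
      ∑ i, ∑ j, a i * b j * cov[fun ω => x ω i, fun ω => x ω j; P] := by
  have hL : ∀ (a : ι → ℝ) i, MemLp (fun ω => a i * x ω i) 2 P := fun a i => (hx i).const_mul (a i)
  have hI : ∀ a : ι → ℝ, Integrable (fun ω => ∑ i, a i * x ω i) P := fun a =>
    integrable_finsetSum _ fun i _ => (hL a i).integrable one_le_two
  rw [covariance_add_const_left (hI a), covariance_add_const_right (hI b),
    covariance_fun_sum_fun_sum (hL a) (hL b)]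
  simp_rw [covariance_const_mul_left, covariance_const_mul_right, mul_assoc]

end Affine

/-! ### The output process and its smeared moments -/

/-- The row vector `√2 B_Nᵀ e^{J_N t}`. -/
noncomputable def outputRow (k τ : ℝ) (N : ℕ) (t : ℝ) : Idx N → ℝ :=
  Real.sqrt 2 • (B k τ N ᵥ* NormedSpace.exp (t • J τ N))

/-- The deterministic response of the approximation to the input `u`. -/
noncomputable def forcedOutput (k τ : ℝ) (N : ℕ) (u : ℝ → ℝ) (t : ℝ) : ℝ :=
  ∫ s in (0 : ℝ)..t, 2 * kappaCausal k τ N (t - s) * u s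

/-- All randomness sits in finitely many coordinates with coefficients continuous in `t`, so time
integrals and expectations are exchanged by finite linearity, without Fubini. -/
lemma output_eq (k τ : ℝ) (N : ℕ) (u : ℝ → ℝ) (x₀ : Idx N → ℝ) (t : ℝ) :
    output k τ N u x₀ t = ∑ i, outputRow k τ N t i * x₀ i + forcedOutput k τ N u t := by
  rw [output, Matrix.dotProduct_mulVec, ← smul_eq_mul, ← smul_dotProduct]
  rfl

lemma continuous_outputRow (k τ : ℝ) (N : ℕ) (i : Idx N) :
    Continuous fun t => outputRow k τ N t i := by
  have h : Continuous fun t => Real.sqrt 2 *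
      ∑ j, B k τ N j * NormedSpace.exp (t • J τ N) j i :=
    continuous_const.mul (continuous_finsetSum _ fun j _ =>
      continuous_const.mul (continuous_exp_smul_matrix_apply (J τ N) j i))
  exact h

lemma forcedOutput_eq (k τ : ℝ) (N : ℕ) (u : ℝ → ℝ) {t : ℝ} (ht : 0 ≤ t) :
    forcedOutput k τ N u t = ∫ s in (0 : ℝ)..t, 2 * kappa k τ N (t - s) * u s := by
  refine intervalIntegral.integral_congr fun s hs => ?_
  rw [uIcc_of_le ht] at hs
  simp [kappaCausal, not_lt.2 hs.2]

lemma continuousOn_forcedOutput {k τ : ℝ} (hτ : 0 < τ) (N : ℕ) {u : ℝ → ℝ}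
    (hu : ContinuousOn u (Icc 0 τ)) : ContinuousOn (forcedOutput k τ N u) (Icc 0 τ) := by
  have hκ := continuous_kappa k τ N
  -- Continuity of `u` is known only on `[0, τ]`; a globally continuous extension allows the
  -- parametric integral theorem to apply.
  set v : ℝ → ℝ := IccExtend hτ.le ((Icc 0 τ).domRestrict u) with hv
  have hvc : Continuous v := (continuousOn_iff_continuous_domRestrict.1 hu).Icc_extend'
  have hc : Continuous fun t => ∫ s in (0 : ℝ)..t, 2 * kappa k τ N (t - s) * v s :=
    intervalIntegral.continuous_parametric_intervalIntegral_of_continuous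
      (f := fun t s => 2 * kappa k τ N (t - s) * v s) (by unfold Function.uncurry; fun_prop)
      continuous_id
  refine hc.continuousOn.congr fun t ht => ?_
  rw [forcedOutput_eq k τ N u ht.1]
  refine intervalIntegral.integral_congr fun s hs => ?_
  rw [uIcc_of_le ht.1] at hs
  simp only [hv, IccExtend_of_mem hτ.le _ (⟨hs.1, hs.2.trans ht.2⟩ : s ∈ Icc 0 τ), domRestrict_apply]

lemma exists_abs_forcedOutput_sub_le {k τ : ℝ} (hτ : 0 < τ) {u : ℝ → ℝ}
    (hu : ContDiffOn ℝ 1 u (Icc 0 τ)) (hu0 : u 0 = 0) :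
    ∃ M, ∀ N, ∀ t ∈ Icc 0 τ, |forcedOutput k τ N u t - k * u t| ≤ M * stepError k τ N := by
  have hc : ContinuousOn (derivWithin u (Icc 0 τ)) (Icc 0 τ) :=
    hu.continuousOn_derivWithin (uniqueDiffOn_Icc hτ) le_rfl
  obtain ⟨M, hM⟩ := isCompact_Icc.exists_bound_of_continuousOn hc
  refine ⟨M, fun N t ht => ?_⟩
  rw [forcedOutput_eq k τ N u ht.1]
  refine abs_integral_kappa_mul_sub_le hτ N hu.continuousOn hc (fun s hs => ?_) hu0 hM ht
  exact ((hu.differentiableOn one_ne_zero s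
    (Ioo_subset_Icc_self hs)).hasDerivWithinAt).hasDerivAt (Icc_mem_nhds hs.1 hs.2)

lemma tendsto_intervalIntegral_of_abs_sub_le {τ : ℝ} (hτ : 0 < τ) {F : ℕ → ℝ → ℝ} {G : ℝ → ℝ}
    {C : ℕ → ℝ} (hC : Tendsto C atTop (𝓝 0))
    (hF : ∀ N, IntervalIntegrable (F N) volume 0 τ) (hG : IntervalIntegrable G volume 0 τ)
    (h : ∀ N, ∀ t ∈ Icc 0 τ, |F N t - G t| ≤ C N) :
    Tendsto (fun N => ∫ t in (0 : ℝ)..τ, F N t) atTop (𝓝 (∫ t in (0 : ℝ)..τ, G t)) := by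
  rw [tendsto_iff_norm_sub_tendsto_zero]
  have hC' : Tendsto (fun N => C N * |τ - 0|) atTop (𝓝 0) := by
    simpa using hC.mul_const |τ - 0|
  refine squeeze_zero (fun _ => norm_nonneg _) (fun N => ?_) hC'
  rw [← intervalIntegral.integral_sub (hF N) hG]
  refine intervalIntegral.norm_integral_le_of_norm_le_const fun t ht => ?_
  rw [uIoc_of_le hτ.le] at ht
  exact h N t ⟨ht.1.le, ht.2⟩

/-- Provides the boundary conditions needed for the integration by parts with test functions. -/
lemma eq_zero_at_endpoints {τ : ℝ} {f : ℝ → ℝ} (hf : Continuous f)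
    (h : ∀ s, s ∉ Icc 0 τ → f s = 0) : f 0 = 0 ∧ f τ = 0 := by
  constructor
  · have : EqOn f 0 (Iio 0) := fun s hs => h s fun h' => not_le.2 hs h'.1
    exact this.closure hf continuous_const (by simp)
  · have : EqOn f 0 (Ioi τ) := fun s hs => h s fun h' => not_le.2 hs h'.2
    exact this.closure hf continuous_const (by simp)

/-- `2 κ_N(t - s)` converges to `2 k δ(t - s)` as a distribution. -/
lemma tendsto_integral_kappa_mul_test {k τ : ℝ} (hτ : 0 < τ) {Φ : ℝ × ℝ → ℝ}
    (hΦ : IsTest₂ τ Φ) :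
    Tendsto (fun N => ∫ t in (0 : ℝ)..τ, ∫ s in (0 : ℝ)..τ, 2 * kappa k τ N (t - s) * Φ (s, t))
      atTop (𝓝 (∫ t in (0 : ℝ)..τ, 2 * k * Φ (t, t))) := by
  have hc : Continuous Φ := hΦ.1.continuous
  have hdiff : Differentiable ℝ Φ := hΦ.1.differentiable (by simp)
  have hc' : Continuous fun p => fderiv ℝ Φ p (1, 0) :=
    (hΦ.1.continuous_fderiv (by simp)).clm_apply continuous_const
  obtain ⟨M, hM⟩ := (isCompact_Icc.prod (isCompact_Icc (a := 0) (b := τ))).exists_bound_of_continuousOn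
    (s := Icc 0 τ ×ˢ Icc 0 τ) hc'.continuousOn
  have hlim : Tendsto (fun N => 2 * M * stepError k τ N) atTop (𝓝 0) := by
    simpa using (tendsto_stepError hτ).const_mul (2 * M)
  refine tendsto_intervalIntegral_of_abs_sub_le hτ hlim (fun N => ?_)
    (Continuous.intervalIntegrable (by fun_prop) _ _) (fun N t ht => ?_)
  · have hκ := continuous_kappa k τ N
    refine Continuous.intervalIntegrable ?_ _ _
    exact intervalIntegral.continuous_parametric_intervalIntegral_of_continuous
      (f := fun t s => 2 * kappa k τ N (t - s) * Φ (s, t)) (by unfold Function.uncurry; fun_prop)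
      continuous_const
  · have hends := eq_zero_at_endpoints (τ := τ) (f := fun s => Φ (s, t)) (by fun_prop)
      fun s hs => image_eq_zero_of_notMem_tsupport fun h' => hs (hΦ.2 h').1
    refine abs_integral_kappa_mul_sub_le_two_sided hτ N (f := fun s => Φ (s, t))
      (f' := fun s => fderiv ℝ Φ (s, t) (1, 0)) (by fun_prop) (fun s => ?_) hends.1 hends.2
      (fun s hs => hM (s, t) ⟨hs, ht⟩) ht
    exact (hdiff (s, t)).hasFDerivAt.comp_hasDerivAt s
      ((hasDerivAt_id s).prodMk (hasDerivAt_const s t))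

/-- The factors are ordered so that `Φ (s, t) = ψ s * φ t`, as in the covariance double integral. -/
lemma IsTest.mul {τ : ℝ} {φ ψ : ℝ → ℝ} (hφ : IsTest τ φ) (hψ : IsTest τ ψ) :
    IsTest₂ τ fun p => ψ p.1 * φ p.2 := by
  refine ⟨(hψ.1.comp contDiff_fst).mul (hφ.1.comp contDiff_snd), ?_⟩
  refine closure_minimal (fun p hp => ?_) (isClosed_Icc.prod isClosed_Icc)
  exact ⟨hψ.2 (subset_tsupport _ (left_ne_zero_of_mul hp)),
    hφ.2 (subset_tsupport _ (right_ne_zero_of_mul hp))⟩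

lemma toGeneralized_output {k τ : ℝ} (hτ : 0 < τ) (N : ℕ) {u : ℝ → ℝ}
    (hu : ContinuousOn u (Icc 0 τ)) {Ω : Type*} (x : Ω → Idx N → ℝ) {φ : ℝ → ℝ}
    (hφ : Continuous φ) (ω : Ω) :
    toGeneralized τ (fun t ω => output k τ N u (x ω) t) φ ω =
      ∑ i, (∫ t in (0 : ℝ)..τ, outputRow k τ N t i * φ t) * x ω i +
        ∫ t in (0 : ℝ)..τ, forcedOutput k τ N u t * φ t := by
  have hrow := continuous_outputRow k τ N
  have hforced : IntervalIntegrable (fun t => forcedOutput k τ N u t * φ t) volume 0 τ := by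
    refine ContinuousOn.intervalIntegrable ?_
    rw [uIcc_of_le hτ.le]
    exact (continuousOn_forcedOutput hτ N hu).mul hφ.continuousOn
  simp only [toGeneralized, output_eq, add_mul, Finset.sum_mul]
  rw [intervalIntegral.integral_add (Continuous.intervalIntegrable (by fun_prop) _ _) hforced,
    intervalIntegral.integral_finsetSum
      fun i _ => Continuous.intervalIntegrable (by fun_prop) _ _]
  congr 1
  refine Finset.sum_congr rfl fun i _ => ?_
  rw [← intervalIntegral.integral_mul_const]
  congr 1
  ext t
  ring

lemma covariance_toGeneralized_output {k τ : ℝ} (hτ : 0 < τ) (N : ℕ) {u : ℝ → ℝ}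
    (hu : ContinuousOn u (Icc 0 τ)) {Ω : Type*} [MeasurableSpace Ω] {P : Measure Ω}
    [IsProbabilityMeasure P] {x : Ω → Idx N → ℝ} (hx : ∀ i, MemLp (fun ω => x ω i) 2 P)
    {φ ψ : ℝ → ℝ} (hφ : Continuous φ) (hψ : Continuous ψ) :
    cov[toGeneralized τ (fun t ω => output k τ N u (x ω) t) φ,
        toGeneralized τ (fun t ω => output k τ N u (x ω) t) ψ; P] =
      ∫ t in (0 : ℝ)..τ, ∫ s in (0 : ℝ)..τ,
        cov[fun ω => output k τ N u (x ω) t, fun ω => output k τ N u (x ω) s; P] *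
          (ψ s * φ t) := by
  have hrow := continuous_outputRow k τ N
  have hgen : ∀ {φ : ℝ → ℝ}, Continuous φ →
      toGeneralized τ (fun t ω => output k τ N u (x ω) t) φ = fun ω =>
        ∑ i, (∫ t in (0 : ℝ)..τ, outputRow k τ N t i * φ t) * x ω i +
          ∫ t in (0 : ℝ)..τ, forcedOutput k τ N u t * φ t :=
    fun hφ => funext fun ω => toGeneralized_output hτ N hu x hφ ω
  rw [hgen hφ, hgen hψ, covariance_affine hx]
  simp only [output_eq, covariance_affine hx]
  have hinner : ∀ (C : Idx N → Idx N → ℝ) (t : ℝ), ∫ s in (0 : ℝ)..τ,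
      (∑ i, ∑ j, outputRow k τ N t i * outputRow k τ N s j * C i j) * (ψ s * φ t) =
      ∑ i, ∑ j, outputRow k τ N t i * φ t *
        ((∫ s in (0 : ℝ)..τ, outputRow k τ N s j * ψ s) * C i j) := by
    intro C t
    simp only [Finset.sum_mul]
    rw [intervalIntegral.integral_finsetSum
      fun i _ => Continuous.intervalIntegrable (by fun_prop) _ _]
    refine Finset.sum_congr rfl fun i _ => ?_
    rw [intervalIntegral.integral_finsetSum
      fun i _ => Continuous.intervalIntegrable (by fun_prop) _ _]
    refine Finset.sum_congr rfl fun j _ => ?_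
    rw [← intervalIntegral.integral_mul_const, ← intervalIntegral.integral_const_mul]
    congr 1
    ext s
    ring
  simp_rw [hinner]
  rw [intervalIntegral.integral_finsetSum
    fun i _ => Continuous.intervalIntegrable (by fun_prop) _ _]
  refine Finset.sum_congr rfl fun i _ => ?_
  rw [intervalIntegral.integral_finsetSum
    fun i _ => Continuous.intervalIntegrable (by fun_prop) _ _]
  refine Finset.sum_congr rfl fun j _ => ?_
  rw [intervalIntegral.integral_mul_const, mul_assoc]

lemma covariance_output_of_hasTemperature {k τ T : ℝ} (hk : 0 < k) (hτ : 0 < τ) {N : ℕ}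
    {Ω : Type*} [MeasurableSpace Ω] {P : Measure Ω} {y : ℝ → Ω → ℝ}
    (hT : HasTemperature (J τ N) (Real.sqrt 2 • B k τ N) T τ P y) {s t : ℝ}
    (hs : s ∈ Icc 0 τ) (ht : t ∈ Icc 0 τ) :
    cov[y t, y s; P] = T * (2 * kappa k τ N (t - s)) := by
  rw [hT s hs t ht, Matrix.mulVec_smul, smul_dotProduct, dotProduct_smul, smul_smul,
    Real.mul_self_sqrt (by norm_num), B_dotProduct_exp_J_mulVec_B hk hτ, smul_eq_mul]

lemma kappa_zero_pos {k τ : ℝ} (hk : 0 < k) (hτ : 0 < τ) (N : ℕ) : 0 < kappa k τ N 0 := by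
  simp only [kappa, mul_zero, Real.cos_zero]
  positivity

/-- The variance at time `0` is `2 T κ_N(0)` with `κ_N(0) > 0`. The sign is what makes `√(2Tk)`
square to `2Tk` in the limit covariance. -/
lemma temperature_nonneg {k τ T : ℝ} (hk : 0 < k) (hτ : 0 < τ) {N : ℕ}
    {Ω : Type*} [MeasurableSpace Ω] {P : Measure Ω} {y : ℝ → Ω → ℝ}
    (hT : HasTemperature (J τ N) (Real.sqrt 2 • B k τ N) T τ P y)
    (hy : AEMeasurable (y 0) P) : 0 ≤ T := by
  have h0 : (0 : ℝ) ∈ Icc 0 τ := ⟨le_rfl, hτ.le⟩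
  have h := covariance_output_of_hasTemperature hk hτ hT h0 h0
  rw [covariance_self hy, sub_self] at h
  have hpos := kappa_zero_pos hk hτ N
  exact nonneg_of_mul_nonneg_left (h ▸ variance_nonneg _ _) (by positivity)

lemma memLp_toGeneralized_output {k τ : ℝ} (hτ : 0 < τ) (N : ℕ) {u : ℝ → ℝ}
    (hu : ContinuousOn u (Icc 0 τ)) {Ω : Type*} [MeasurableSpace Ω] {P : Measure Ω}
    [IsProbabilityMeasure P] {x : Ω → Idx N → ℝ} (hx : ∀ i, MemLp (fun ω => x ω i) 2 P)
    {φ : ℝ → ℝ} (hφ : Continuous φ) :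
    MemLp (toGeneralized τ (fun t ω => output k τ N u (x ω) t) φ) 2 P := by
  have h := memLp_affine hx (fun i => ∫ t in (0 : ℝ)..τ, outputRow k τ N t i * φ t)
    (∫ t in (0 : ℝ)..τ, forcedOutput k τ N u t * φ t)
  exact (memLp_congr_ae (Eventually.of_forall (toGeneralized_output hτ N hu x hφ))).2 h

lemma integral_toGeneralized_output {k τ : ℝ} (hτ : 0 < τ) (N : ℕ) {u : ℝ → ℝ}
    (hu : ContinuousOn u (Icc 0 τ)) {Ω : Type*} [MeasurableSpace Ω] {P : Measure Ω}
    [IsProbabilityMeasure P] {x : Ω → Idx N → ℝ} (hx : ∀ i, MemLp (fun ω => x ω i) 2 P)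
    (hx0 : ∀ i, ∫ ω, x ω i ∂P = 0) {φ : ℝ → ℝ} (hφ : Continuous φ) :
    ∫ ω, toGeneralized τ (fun t ω => output k τ N u (x ω) t) φ ω ∂P =
      ∫ t in (0 : ℝ)..τ, forcedOutput k τ N u t * φ t := by
  rw [integral_congr_ae (Eventually.of_forall (toGeneralized_output hτ N hu x hφ))]
  exact integral_affine hx hx0 _ _

/-! ### Moments of the limit process -/

section LimitOutput

variable {k T τ : ℝ} {u : ℝ → ℝ} {Ω' : Type*} [MeasurableSpace Ω'] {P' : Measure Ω'}
  [IsProbabilityMeasure P'] {w : (ℝ → ℝ) → Ω' → ℝ} {φ ψ : ℝ → ℝ}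

lemma IsWhiteNoise.integrable_const_mul (hw : IsWhiteNoise τ P' w) (hφ : IsTest τ φ) (c : ℝ) :
    Integrable (fun ω => c * w φ ω) P' :=
  ((hw.memLp φ hφ).integrable one_le_two).const_mul c

lemma memLp_limitOutput (hw : IsWhiteNoise τ P' w) (hφ : IsTest τ φ) :
    MemLp (limitOutput k T τ u w φ) 2 P' :=
  MemLp.add (f := fun _ => ∫ t in (0 : ℝ)..τ, k * u t * φ t) (memLp_const _)
    ((hw.memLp φ hφ).const_mul (Real.sqrt (2 * T * k)))

lemma integral_limitOutput (hw : IsWhiteNoise τ P' w) (hφ : IsTest τ φ) :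
    ∫ ω, limitOutput k T τ u w φ ω ∂P' = ∫ t in (0 : ℝ)..τ, k * u t * φ t := by
  simp only [limitOutput]
  rw [integral_add (integrable_const _) (hw.integrable_const_mul hφ _), integral_const_mul,
    hw.mean φ hφ]
  simp

lemma covariance_limitOutput (hk : 0 ≤ k) (hT : 0 ≤ T) (hw : IsWhiteNoise τ P' w)
    (hφ : IsTest τ φ) (hψ : IsTest τ ψ) :
    cov[limitOutput k T τ u w φ, limitOutput k T τ u w ψ; P'] =
      2 * T * k * ∫ t in (0 : ℝ)..τ, φ t * ψ t := by
  unfold limitOutput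
  rw [covariance_const_add_left (hw.integrable_const_mul hφ _),
    covariance_const_add_right (hw.integrable_const_mul hψ _), covariance_const_mul_left,
    covariance_const_mul_right, hw.covar φ ψ hφ hψ, ← mul_assoc,
    Real.mul_self_sqrt (by positivity)]

end LimitOutput

end HeatBath

/-! ### Assembly of the theorem -/

theorem proposition2 (k τ T : ℝ) (hk : 0 < k) (hτ : 0 < τ)
    (u : ℝ → ℝ) (hu : ContDiffOn ℝ 2 u (Icc 0 τ)) (hu0 : u 0 = 0)
    {Ω : ℕ → Type*} [∀ N, MeasurableSpace (Ω N)]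
    (P : ∀ N, Measure (Ω N)) [∀ N, IsProbabilityMeasure (P N)]
    (x : ∀ N, Ω N → HeatBath.Idx N → ℝ)
    (hx : ∀ N i, MemLp (fun ω => x N ω i) 2 (P N))
    (hx0 : ∀ N i, ∫ ω, x N ω i ∂(P N) = 0)
    (hT : ∀ N, HeatBath.HasTemperature (HeatBath.J τ N) (Real.sqrt 2 • HeatBath.B k τ N) T τ (P N)
      (fun t ω => HeatBath.output k τ N u (x N ω) t)) :
    -- the mean of the output converges to `k u` uniformly on `[0, τ]`
    TendstoUniformlyOn (fun N t => ∫ ω, HeatBath.output k τ N u (x N ω) t ∂(P N))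
      (fun t => k * u t) atTop (Icc 0 τ) ∧
    -- the covariance function of the output converges to `2 T k δ(t - s)` as a distribution
    (∀ Φ : ℝ × ℝ → ℝ, HeatBath.IsTest₂ τ Φ →
      Tendsto (fun N => ∫ t in (0 : ℝ)..τ, ∫ s in (0 : ℝ)..τ,
          cov[fun ω => HeatBath.output k τ N u (x N ω) t,
            fun ω => HeatBath.output k τ N u (x N ω) s; P N] * Φ (s, t))
        atTop (𝓝 (2 * T * k * ∫ t in (0 : ℝ)..τ, Φ (t, t)))) ∧
    -- unit white noise exists, and the output converges to `k u + √(2 T k) w` for any such `w`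
    (∃ (Ω' : Type) (_ : MeasurableSpace Ω') (P' : Measure Ω') (w : (ℝ → ℝ) → Ω' → ℝ),
      IsProbabilityMeasure P' ∧ HeatBath.IsWhiteNoise τ P' w) ∧
    (∀ (Ω' : Type*) [MeasurableSpace Ω'] (P' : Measure Ω') [IsProbabilityMeasure P']
      (w : (ℝ → ℝ) → Ω' → ℝ), HeatBath.IsWhiteNoise τ P' w →
      HeatBath.ConvergesSecondOrder τ P P'
        (fun N => HeatBath.toGeneralized τ (fun t ω => HeatBath.output k τ N u (x N ω) t))
        (HeatBath.limitOutput k T τ u w)) := by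

  have huc : ContinuousOn u (Icc 0 τ) := hu.continuousOn
  obtain ⟨M, hM⟩ := HeatBath.exists_abs_forcedOutput_sub_le (k := k) hτ
    (hu.of_le one_le_two) hu0
  have herr : Tendsto (fun N => M * HeatBath.stepError k τ N) atTop (𝓝 0) := by
    simpa using (HeatBath.tendsto_stepError hτ).const_mul M
  have hyL : ∀ N t, MemLp (fun ω => HeatBath.output k τ N u (x N ω) t) 2 (P N) := fun N t => by
    simp only [HeatBath.output_eq]
    exact HeatBath.memLp_affine (hx N) _ _
  have hT0 : 0 ≤ T := HeatBath.temperature_nonneg hk hτ (hT 0) (hyL 0 0).aemeasurable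
  have hcov : ∀ Φ : ℝ × ℝ → ℝ, HeatBath.IsTest₂ τ Φ →
      Tendsto (fun N => ∫ t in (0 : ℝ)..τ, ∫ s in (0 : ℝ)..τ,
          cov[fun ω => HeatBath.output k τ N u (x N ω) t,
            fun ω => HeatBath.output k τ N u (x N ω) s; P N] * Φ (s, t))
        atTop (𝓝 (2 * T * k * ∫ t in (0 : ℝ)..τ, Φ (t, t))) := by
    intro Φ hΦ
    have h := (HeatBath.tendsto_integral_kappa_mul_test (k := k) hτ hΦ).const_mul T
    rw [intervalIntegral.integral_const_mul, ← mul_assoc,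
      show T * (2 * k) = 2 * T * k by ring] at h
    refine h.congr fun N => ?_
    rw [← intervalIntegral.integral_const_mul]
    refine intervalIntegral.integral_congr fun t ht => ?_
    rw [uIcc_of_le hτ.le] at ht
    rw [← intervalIntegral.integral_const_mul]
    refine intervalIntegral.integral_congr fun s hs => ?_
    rw [uIcc_of_le hτ.le] at hs
    rw [HeatBath.covariance_output_of_hasTemperature hk hτ (hT N) hs ht]
    ring
  refine ⟨?_, hcov, HeatBath.exists_isWhiteNoise hτ, ?_⟩
  · rw [Metric.tendstoUniformlyOn_iff]
    intro ε hε
    filter_upwards [herr.eventually_lt_const hε] with N hN t ht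
    simp only [HeatBath.output_eq]
    rw [HeatBath.integral_affine (hx N) (hx0 N), dist_comm, Real.dist_eq]
    exact (hM N t ht).trans_lt hN
  · intro Ω' _ P' _ w hw
    refine ⟨fun N φ hφ => ?_, fun φ hφ => ?_, fun φ hφ => ?_, fun φ ψ hφ hψ => ?_⟩
    · exact HeatBath.memLp_toGeneralized_output hτ N huc (hx N) hφ.continuous
    · exact HeatBath.memLp_limitOutput hw hφ
    · rw [HeatBath.integral_limitOutput hw hφ]
      obtain ⟨C, hC⟩ := isCompact_Icc.exists_bound_of_continuousOn
        (hφ.continuous.continuousOn (s := Icc 0 τ))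
      simp_rw [fun N => HeatBath.integral_toGeneralized_output (k := k) hτ N huc (hx N) (hx0 N)
        hφ.continuous]
      have hint : ∀ {f : ℝ → ℝ}, ContinuousOn f (Icc 0 τ) →
          IntervalIntegrable (fun t => f t * φ t) volume 0 τ := fun hf => by
        refine ContinuousOn.intervalIntegrable ?_
        rw [uIcc_of_le hτ.le]
        exact hf.mul hφ.continuous.continuousOn
      refine HeatBath.tendsto_intervalIntegral_of_abs_sub_le hτ
        (C := fun N => M * HeatBath.stepError k τ N * C) (by simpa using herr.mul_const C)
        (fun N => hint (HeatBath.continuousOn_forcedOutput hτ N huc))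
        (hint (continuousOn_const.mul huc)) (fun N t ht => ?_)
      rw [← sub_mul, abs_mul]
      exact mul_le_mul (hM N t ht) (hC t ht) (abs_nonneg _) ((abs_nonneg _).trans (hM N t ht))
    · rw [HeatBath.covariance_limitOutput hk.le hT0 hw hφ hψ]
      simp_rw [mul_comm (φ _)]
      -- Covariance convergence of smeared outputs is the distributional limit tested on a product
      -- function.
      refine (hcov _ (hφ.mul hψ)).congr fun N => ?_
      exact (HeatBath.covariance_toGeneralized_output hτ N huc (hx N)
        hφ.continuous hψ.continuous).symm
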